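/- **Theorem (Asymptotic No-Regret of ECPv2).** Let $\mathcal X\subset\mathbb R^d$ be compact and convex with non-empty interior, and let $f:\mathcal X\to\mathbb R$ be $k$-Lipschitz for the Euclidean norm, for some $k>0$ (not known to the algorithm). Fix $\delta\in[0,1)$, $\varepsilon_1>0$, an integer $m\ge 1$, $\beta>1$, $C>1$, and growth factors $\tau_{n,d}$ $(n\in\mathbb N)$ bounded away from $1$: there is $\tau_0>1$ with $\tau_{n,d}\ge\tau_0$ for all $n$ (for instance a constant $\tau>1$). For a budget $n\ge1$, write $\tau=\tau_{n,d}$. ECPv2 proceeds as follows. *Projection.* If $\delta=0$, put $\mathbf P=\mathbf I_d$. If $\delta>0$, put $d'=\lceil 8\log(\beta n)/(\delta^2-\delta^3)\rceil$ and $\mathbf P=\frac1{\sqrt{d'}}R^\top$, where $R\in\mathbb R^{d\times d'}$ has i.i.d. $\mathcal N(0,1)$ entries. All candidates below are i.i.d. uniform on $\mathcal X$ and independent of $R$. *Acceptance region.* Given evaluated points $x_1,\dots,x_t$, let $\varepsilon_t^{\oslash}=\bigl(\max_{i\le t}f(x_i)-\min_{i\le t}f(x_i)\bigr)/\operatorname{diam}(\mathcal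 X)$, and let $\mathcal I_t^m$ minimize $\sum_{i\in S}f(x_i)$ over $S\subseteq\{1,\dots,t\}$ with $|S|=\min(m,t)$, ties being broken by an arbitrary fixed rule. Let $$\mathcal A(\varepsilon,t)=\Bigl\{x\in\mathcal X:\ \min_{i\in\mathcal I_t^m}\Bigl(f(x_i)+\tfrac{\max\{\varepsilon,\varepsilon_t^{\oslash}\}}{\sqrt{1-\delta}}\,\|\mathbf Px-\mathbf Px_i\|_2\Bigr)\ \ge\ \max_{j\le t}f(x_j)\Bigr\}.$$ *Iteration.* Draw $x_1$ uniformly on $\mathcal X$ and evaluate it; set $t=1$, $\varepsilon=\varepsilon_1$ and counters $h_{\rm prev}=1$, $h=0$. While $t<n$: draw a candidate $x$ and increase $h$ by $1$; if $h-h_{\rm prev}>C$, replace $\varepsilon$ by $\tau\varepsilon$ and set $h=0$; then, if $x\in\mathcal A(\varepsilon,t)$, evaluate $x_{t+1}=x$, increase $t$ by $1$, replace $\varepsilon$ by $\max\{\tau\varepsilon,\varepsilon_t^{\oslash}\}$ (with the new $t$), set $h_{\rm prev}=h$ and then $h=0$. Then for every $n\ge1$ the loop terminates almost surely, so that $x_1,\dots,x_n$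 are almost surely defined, and the simple regret $$\mathcal R_{\mathrm{ECPv2},f}(n)=\max_{x\in\mathcal X}f(x)-\max_{1\le i\le n}f(x_i)$$ of the run with budget $n$ converges to $0$ in probability as $n\to\infty$. -/

import Mathlib

open MeasureTheory ProbabilityTheory Filter Topology

noncomputable section

namespace ECPv2

/-- The ambient space `ℝ^d` with its Euclidean norm. -/
abbrev E (d : ℕ) : Type := EuclideanSpace ℝ (Fin d)

/-! ### The projection -/

/-- Target dimension `d'` of the projection for budget `n`: the integer
`⌈8 log (β n) / (δ² - δ³)⌉` if `δ > 0`, and `d` if `δ = 0` (no projection). -/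
def projDim (d : ℕ) (δ β : ℝ) (n : ℕ) : ℕ :=
  if 0 < δ then ⌈8 * Real.log (β * n) / (δ ^ 2 - δ ^ 3)⌉₊ else d

/-- The projection matrix `P = (1/√d') Rᵀ` if `δ > 0`, and `P = I_d` if `δ = 0`
(in that case `projDim d δ β n = d`, and the entries below are those of the identity). -/
def projMatrix (d : ℕ) (δ β : ℝ) (n : ℕ)
    (R : Matrix (Fin d) (Fin (projDim d δ β n)) ℝ) :
    Matrix (Fin (projDim d δ β n)) (Fin d) ℝ :=
  fun i j =>
    if 0 < δ then (1 / √(projDim d δ β n : ℝ)) * R j i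
    else if (i : ℕ) = (j : ℕ) then 1 else 0

/-- The vector `P x`, in Euclidean space. -/
def proj {d p : ℕ} (P : Matrix (Fin p) (Fin d) ℝ) (x : E d) : E p :=
  WithLp.toLp 2 (P.mulVec x.ofLp)

/-! ### Archive statistics; the archive is `x 1, …, x t` -/

/-- `max_{1 ≤ i ≤ t} f (x i)`. -/
def fMax {d : ℕ} (f : E d → ℝ) (x : ℕ → E d) (t : ℕ) : ℝ :=
  sSup ((fun i => f (x i)) '' Set.Icc 1 t)

/-- `min_{1 ≤ i ≤ t} f (x i)`. -/
def fMin {d : ℕ} (f : E d → ℝ) (x : ℕ → E d) (t : ℕ) : ℝ :=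
  sInf ((fun i => f (x i)) '' Set.Icc 1 t)

/-- The adaptive lower bound
`ε_t^⊘ = (max_{i ≤ t} f (x i) - min_{i ≤ t} f (x i)) / diam X`. -/
def epsLower {d : ℕ} (X : Set (E d)) (f : E d → ℝ) (x : ℕ → E d) (t : ℕ) : ℝ :=
  (fMax f x t - fMin f x t) / Metric.diam X

/-- `S` is a worst-`m` set of the archive `x 1, …, x t`: among the sets of `m` indices in
`{1, …, t}` (of all `t` indices if `t < m`) it minimizes the sum of the values of `f`. -/
def IsWorstSet {d : ℕ} (f : E d → ℝ) (m : ℕ) (t : ℕ) (x : ℕ → E d) (S : Finset ℕ) : Prop :=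
  S ⊆ Finset.Icc 1 t ∧ S.card = min m t ∧
    ∀ S' : Finset ℕ, S' ⊆ Finset.Icc 1 t → S'.card = min m t →
      ∑ i ∈ S, f (x i) ≤ ∑ i ∈ S', f (x i)

/-- The acceptance region: the `y ∈ X` with
`min_{i ∈ S} (f (x i) + max {ε, ε_t^⊘} / √(1 - δ) * ‖P y - P (x i)‖) ≥ max_{j ≤ t} f (x j)`,
where `S` is the worst-`m` set in use. -/
def acceptRegion {d p : ℕ} (X : Set (E d)) (f : E d → ℝ) (δ : ℝ)
    (P : Matrix (Fin p) (Fin d) ℝ) (S : Finset ℕ) (ε : ℝ) (t : ℕ) (x : ℕ → E d) : Set (E d) :=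
  {y | y ∈ X ∧ ∀ i ∈ S,
    fMax f x t ≤
      f (x i) + max ε (epsLower X f x t) / √(1 - δ) * ‖proj P y - proj P (x i)‖}

/-! ### The algorithm -/

/-- The state of a run: the number `t` of evaluated points, the evaluated points
`x 1, …, x t`, the current value `ε = ε_t`, and the counters `hPrev = h_t`, `hCur = h_{t+1}`. -/
structure State (d : ℕ) where
  t : ℕ
  x : ℕ → E d
  ε : ℝ
  hPrev : ℕ
  hCur : ℕ

/-- The state after the evaluation of the first point `u = x₁`. -/
def initState {d : ℕ} (ε₁ : ℝ) (u : E d) : State d where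
  t := 1
  x := fun _ => u
  ε := ε₁
  hPrev := 1
  hCur := 0

open Classical in
/-- One pass through the body of the `while t < n` loop, with candidate `u`.
`sel t x` is the worst-`m` set used for the archive `x 1, …, x t`. -/
def step {d p : ℕ} (n : ℕ) (X : Set (E d)) (f : E d → ℝ) (δ : ℝ)
    (P : Matrix (Fin p) (Fin d) ℝ) (τ C : ℝ) (sel : ℕ → (ℕ → E d) → Finset ℕ)
    (s : State d) (u : E d) : State d :=
  if s.t < n then
    let h : ℕ := s.hCur + 1
    let grow : Prop := (h : ℝ) - (s.hPrev : ℝ) > C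
    let ε : ℝ := if grow then τ * s.ε else s.ε
    let h' : ℕ := if grow then 0 else h
    if u ∈ acceptRegion X f δ P (sel s.t s.x) ε s.t s.x then
      let x' : ℕ → E d := Function.update s.x (s.t + 1) u
      { t := s.t + 1
        x := x'
        ε := max (τ * ε) (epsLower X f x' (s.t + 1))
        hPrev := h'
        hCur := 0 }
    else
      { t := s.t
        x := s.x
        ε := ε
        hPrev := s.hPrev
        hCur := h' }
  else s

/-- The state after `j` candidates have been processed, when the points drawn uniformly
are `u 0` (the first query), `u 1`, `u 2`, … (the successive candidates). -/
def run {d p : ℕ} (n : ℕ) (X : Set (E d)) (f : E d → ℝ) (δ : ℝ)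
    (P : Matrix (Fin p) (Fin d) ℝ) (ε₁ τ C : ℝ) (sel : ℕ → (ℕ → E d) → Finset ℕ)
    (u : ℕ → E d) : ℕ → State d
  | 0 => initState ε₁ (u 0)
  | j + 1 => step n X f δ P τ C sel (run n X f δ P ε₁ τ C sel u j) (u (j + 1))

/-- The run with budget `n` evaluates `n` points and stops, after finitely many candidates. -/
def Terminates {d p : ℕ} (n : ℕ) (X : Set (E d)) (f : E d → ℝ) (δ : ℝ)
    (P : Matrix (Fin p) (Fin d) ℝ) (ε₁ τ C : ℝ) (sel : ℕ → (ℕ → E d) → Finset ℕ)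
    (u : ℕ → E d) : Prop :=
  ∃ j, (run n X f δ P ε₁ τ C sel u j).t = n

/-- The evaluated points `x 1, …, x n` of the run with budget `n`, read off when
the loop stops. -/
def evaluated {d p : ℕ} (n : ℕ) (X : Set (E d)) (f : E d → ℝ) (δ : ℝ)
    (P : Matrix (Fin p) (Fin d) ℝ) (ε₁ τ C : ℝ) (sel : ℕ → (ℕ → E d) → Finset ℕ)
    (u : ℕ → E d) : ℕ → E d :=
  (run n X f δ P ε₁ τ C sel u
    (sInf {j | (run n X f δ P ε₁ τ C sel u j).t = n})).x

/-- The simple regret `max_{x ∈ X} f x - max_{1 ≤ i ≤ n} f (x i)`. -/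
def regret {d p : ℕ} (n : ℕ) (X : Set (E d)) (f : E d → ℝ) (δ : ℝ)
    (P : Matrix (Fin p) (Fin d) ℝ) (ε₁ τ C : ℝ) (sel : ℕ → (ℕ → E d) → Finset ℕ)
    (u : ℕ → E d) : ℝ :=
  sSup (f '' X) - fMax f (evaluated n X f δ P ε₁ τ C sel u) n

/-- The law of the random inputs of one run: `R` has i.i.d. standard Gaussian entries,
`U 0, U 1, …` are i.i.d. uniform on `X`, and `R` is independent of `(U j)_j`. -/
structure IsInput {Ω : Type*} [MeasurableSpace Ω] (μ : Measure Ω) {d p : ℕ} (X : Set (E d))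
    (R : Ω → Matrix (Fin d) (Fin p) ℝ) (U : ℕ → Ω → E d) : Prop where
  measurable_R : ∀ i j, Measurable (fun ω => R ω i j)
  law_R : ∀ i j, μ.map (fun ω => R ω i j) = gaussianReal 0 1
  iIndep_R : iIndepFun (fun (q : Fin d × Fin p) ω => R ω q.1 q.2) μ
  measurable_U : ∀ j, Measurable (U j)
  law_U : ∀ j, pdf.IsUniform (U j) X μ volume
  iIndep_U : iIndepFun U μ
  indep_R_U : IndepFun (fun ω (q : Fin d × Fin p) => R ω q.1 q.2) (fun ω j => U j ω) μ

end ECPv2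

end

namespace ECPv2

/-! ### The projection and the archive statistics -/

/-! The parameter `ε` is multiplied by at least `τ₀` at each acceptance and whenever rejections pile
up, and the waiting time between two growths increases at most linearly in the number of growths. So
in an unfinished run `ε` exceeds any fixed level after `N` candidates, where `N` depends neither on
the budget, nor on the projection, nor on the draws (`exists_eps_large`).

Suppose that `‖v‖ ≤ 2 * ‖P v‖` for all `v`. Once `ε ≥ 2 k √(1 - δ)`, the Lipschitz bound shows that
every point improving on the archive is accepted, so the best value dominates that of each later
candidate (`le_fMax_run`). The run thus does at least as well as pure random search on the
candidates `N + 1, …, n - 1`, all of which are processed because a candidate adds at most one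
evaluation. By convexity the near-maximal points contain a nonempty open set
(`exists_open_near_sup`), which these candidates miss with probability `q ^ (n - (N + 1))`.

The hypothesis on `P` fails with probability tending to `0`: `d` is fixed while `d'` tends to
infinity with `n`, so Chebyshev's inequality on the `d²` Gram entries gives a failure probability of
order `1 / d'` (`exists_measure_contraction_le`).

Termination must hold for every `n`, even when `P` has a kernel; there `P ≠ 0` suffices
(`terminates_of_recurrent`). Were the archive to freeze, some open set would have projections at
positive distance from those of the archive, and its points would be accepted once `ε` is large. -/

lemma proj_sub {d p : ℕ} (P : Matrix (Fin p) (Fin d) ℝ) (x y : E d) :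
    proj P (x - y) = proj P x - proj P y := by
  simp [proj, Matrix.mulVec_sub]

lemma proj_add {d p : ℕ} (P : Matrix (Fin p) (Fin d) ℝ) (x y : E d) :
    proj P (x + y) = proj P x + proj P y := by
  simp [proj, Matrix.mulVec_add]

lemma proj_smul {d p : ℕ} (P : Matrix (Fin p) (Fin d) ℝ) (c : ℝ) (x : E d) :
    proj P (c • x) = c • proj P x := by
  simp [proj, Matrix.mulVec_smul]

lemma continuous_proj {d p : ℕ} (P : Matrix (Fin p) (Fin d) ℝ) : Continuous (proj P) := by
  unfold proj
  fun_prop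

lemma le_fMax {d : ℕ} (f : E d → ℝ) (x : ℕ → E d) {t i : ℕ} (hi : i ∈ Set.Icc 1 t) :
    f (x i) ≤ fMax f x t :=
  le_csSup ((Set.finite_Icc 1 t).image _).bddAbove ⟨i, hi, rfl⟩

lemma fMax_le {d : ℕ} (f : E d → ℝ) (x : ℕ → E d) {t : ℕ} (ht : 1 ≤ t) {a : ℝ}
    (h : ∀ i ∈ Set.Icc 1 t, f (x i) ≤ a) : fMax f x t ≤ a := by
  refine csSup_le (Set.Nonempty.image _ ⟨1, le_rfl, ht⟩) ?_
  rintro _ ⟨i, hi, rfl⟩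
  exact h i hi

/-! ### Deterministic properties of a run -/

section Run

variable {d p n : ℕ} {X : Set (E d)} {f : E d → ℝ} {δ : ℝ} {P : Matrix (Fin p) (Fin d) ℝ}
  {ε₁ τ C : ℝ} {sel : ℕ → (ℕ → E d) → Finset ℕ}

/-- The effect of a pass through the loop: `ε'` and `h'` are the values of the parameter and of
the counter when the candidate is tested. -/
lemma step_eq (s : State d) (u : E d) (hs : s.t < n) :
    ∃ (ε' : ℝ) (h' : ℕ),
      ((C < ((s.hCur + 1 : ℕ) : ℝ) - s.hPrev ∧ ε' = τ * s.ε ∧ h' = 0) ∨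
        (((s.hCur + 1 : ℕ) : ℝ) - s.hPrev ≤ C ∧ ε' = s.ε ∧ h' = s.hCur + 1)) ∧
      ((u ∈ acceptRegion X f δ P (sel s.t s.x) ε' s.t s.x ∧
          step n X f δ P τ C sel s u =
            { t := s.t + 1
              x := Function.update s.x (s.t + 1) u
              ε := max (τ * ε') (epsLower X f (Function.update s.x (s.t + 1) u) (s.t + 1))
              hPrev := h'
              hCur := 0 }) ∨
        (u ∉ acceptRegion X f δ P (sel s.t s.x) ε' s.t s.x ∧
          step n X f δ P τ C sel s u =
            { t := s.t, x := s.x, ε := ε', hPrev := s.hPrev, hCur := h' })) := by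
  classical
  refine ⟨if ((s.hCur + 1 : ℕ) : ℝ) - s.hPrev > C then τ * s.ε else s.ε,
    if ((s.hCur + 1 : ℕ) : ℝ) - s.hPrev > C then 0 else s.hCur + 1, ?_, ?_⟩
  · by_cases g : C < ((s.hCur + 1 : ℕ) : ℝ) - s.hPrev
    · left; exact ⟨g, if_pos g, if_pos g⟩
    · right; exact ⟨not_lt.1 g, if_neg g, if_neg g⟩
  · rw [step, if_pos hs]
    dsimp only
    by_cases h : u ∈ acceptRegion X f δ P (sel s.t s.x)
        (if ((s.hCur + 1 : ℕ) : ℝ) - s.hPrev > C then τ * s.ε else s.ε) s.t s.x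
    · left
      refine ⟨h, ?_⟩
      convert if_pos h
    · right
      refine ⟨h, ?_⟩
      convert if_neg h

/-- A pass through the loop keeps the archive, or appends the candidate to it. -/
lemma step_archive (s : State d) (u : E d) :
    ((step n X f δ P τ C sel s u).t = s.t ∧ (step n X f δ P τ C sel s u).x = s.x) ∨
    (s.t < n ∧ u ∈ X ∧ (step n X f δ P τ C sel s u).t = s.t + 1 ∧
      (step n X f δ P τ C sel s u).x = Function.update s.x (s.t + 1) u) := by
  by_cases hs : s.t < n
  · obtain ⟨ε', h', -, ⟨h, he⟩ | ⟨-, he⟩⟩ := step_eq (X := X) (f := f) (δ := δ) (P := P) (τ := τ)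
      (C := C) (sel := sel) s u hs
    · rw [he]; exact Or.inr ⟨hs, h.1, rfl, rfl⟩
    · rw [he]; exact Or.inl ⟨rfl, rfl⟩
  · simp [step, hs]

/-- A candidate that satisfies the acceptance inequalities for some `K ≤ ε` is accepted. -/
lemma step_accept (s : State d) (u : E d) (hs : s.t < n) (hτ : 1 ≤ τ) {K : ℝ} (hε : 0 ≤ s.ε)
    (hK : K ≤ s.ε) (hu : u ∈ X)
    (h : ∀ i ∈ sel s.t s.x,
      fMax f s.x s.t ≤ f (s.x i) + K / √(1 - δ) * ‖proj P u - proj P (s.x i)‖) :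
    (step n X f δ P τ C sel s u).t = s.t + 1 ∧
      (step n X f δ P τ C sel s u).x = Function.update s.x (s.t + 1) u := by
  have hτε : s.ε ≤ τ * s.ε := le_mul_of_one_le_left hε hτ
  obtain ⟨ε', h', hε', ⟨-, he⟩ | ⟨hn, -⟩⟩ := step_eq (X := X) (f := f) (δ := δ) (P := P) (τ := τ)
    (C := C) (sel := sel) s u hs
  · rw [he]; exact ⟨rfl, rfl⟩
  · refine absurd ⟨hu, fun i hi => (h i hi).trans ?_⟩ hn
    have h1 : s.ε ≤ ε' := by rcases hε' with ⟨-, rfl, -⟩ | ⟨-, rfl, -⟩ <;> linarith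
    have : K ≤ max ε' (epsLower X f s.x s.t) := (hK.trans h1).trans (le_max_left _ _)
    gcongr

lemma one_le_run_t (u : ℕ → E d) (j : ℕ) : 1 ≤ (run n X f δ P ε₁ τ C sel u j).t := by
  induction j with
  | zero => exact le_rfl
  | succ j ih =>
    simp only [run]
    rcases step_archive (n := n) (X := X) (f := f) (δ := δ) (P := P) (τ := τ) (C := C) (sel := sel)
      (run n X f δ P ε₁ τ C sel u j) (u (j + 1)) with h | h <;> omega

lemma run_t_mono_succ (u : ℕ → E d) (j : ℕ) :
    (run n X f δ P ε₁ τ C sel u j).t ≤ (run n X f δ P ε₁ τ C sel u (j + 1)).t := by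
  simp only [run]
  rcases step_archive (n := n) (X := X) (f := f) (δ := δ) (P := P) (τ := τ) (C := C) (sel := sel)
      (run n X f δ P ε₁ τ C sel u j) (u (j + 1)) with h | h <;> omega

lemma run_t_mono (u : ℕ → E d) : Monotone fun j => (run n X f δ P ε₁ τ C sel u j).t :=
  monotone_nat_of_le_succ (run_t_mono_succ u)

/-- A candidate adds at most one evaluation; hence no run with budget `n` stops before its
candidates `1, …, n - 1` are processed. -/
lemma run_t_le_succ (u : ℕ → E d) (j : ℕ) : (run n X f δ P ε₁ τ C sel u j).t ≤ j + 1 := by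
  induction j with
  | zero => exact le_rfl
  | succ j ih =>
    simp only [run]
    rcases step_archive (n := n) (X := X) (f := f) (δ := δ) (P := P) (τ := τ) (C := C) (sel := sel)
      (run n X f δ P ε₁ τ C sel u j) (u (j + 1)) with h | h <;> omega

lemma run_t_le (hn : 1 ≤ n) (u : ℕ → E d) (j : ℕ) :
    (run n X f δ P ε₁ τ C sel u j).t ≤ n := by
  induction j with
  | zero => exact hn
  | succ j ih =>
    simp only [run]
    rcases step_archive (n := n) (X := X) (f := f) (δ := δ) (P := P) (τ := τ) (C := C) (sel := sel)
      (run n X f δ P ε₁ τ C sel u j) (u (j + 1)) with h | h <;> omega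

/-- The archive starts as the constant function `u 0`, so the index `i` need not be that of an
evaluated point. -/
lemma run_x_mem (u : ℕ → E d) (hu : ∀ j, u j ∈ X) (j i : ℕ) :
    (run n X f δ P ε₁ τ C sel u j).x i ∈ X := by
  induction j with
  | zero => exact hu 0
  | succ j ih =>
    simp only [run]
    rcases step_archive (n := n) (X := X) (f := f) (δ := δ) (P := P) (τ := τ) (C := C) (sel := sel)
      (run n X f δ P ε₁ τ C sel u j) (u (j + 1)) with h | h
    · rw [h.2]; exact ih
    · rw [h.2.2.2]
      by_cases hi : i = (run n X f δ P ε₁ τ C sel u j).t + 1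
      · rw [hi, Function.update_self]; exact h.2.1
      · rw [Function.update_of_ne hi]; exact ih

lemma fMax_run_mono (u : ℕ → E d) : Monotone fun j =>
    fMax f (run n X f δ P ε₁ τ C sel u j).x (run n X f δ P ε₁ τ C sel u j).t := by
  refine monotone_nat_of_le_succ fun j => ?_
  refine fMax_le _ _ (one_le_run_t u j) fun i hi => ?_
  simp only [run]
  rcases step_archive (n := n) (X := X) (f := f) (δ := δ) (P := P) (τ := τ) (C := C) (sel := sel)
      (run n X f δ P ε₁ τ C sel u j) (u (j + 1)) with h | h
  · rw [h.1, h.2]; exact le_fMax _ _ hi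
  · rw [h.2.2.1, h.2.2.2]
    have hne : i ≠ (run n X f δ P ε₁ τ C sel u j).t + 1 := by have := hi.2; omega
    have hi' : i ∈ Set.Icc 1 ((run n X f δ P ε₁ τ C sel u j).t + 1) := ⟨hi.1, by have := hi.2; omega⟩
    have := le_fMax f (Function.update (run n X f δ P ε₁ τ C sel u j).x
      ((run n X f δ P ε₁ τ C sel u j).t + 1) (u (j + 1))) hi'
    rwa [Function.update_of_ne hne] at this

/-- After `j` candidates, `ε` has been multiplied by `τ` at least `G` times, where `j` is bounded
by a quadratic polynomial in `G`. -/
lemma exists_growth {τ₀ : ℝ} (hτ₀ : 1 < τ₀) (hτ : τ₀ ≤ τ) (hC : 1 < C) (hε₁ : 0 < ε₁)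
    (u : ℕ → E d) (j : ℕ) (hj : (run n X f δ P ε₁ τ C sel u j).t < n) :
    ∃ G : ℕ, ε₁ * τ₀ ^ G ≤ (run n X f δ P ε₁ τ C sel u j).ε ∧
      ((run n X f δ P ε₁ τ C sel u j).hPrev : ℝ) ≤ 1 + C * G ∧
      ((run n X f δ P ε₁ τ C sel u j).hCur : ℝ) ≤ (run n X f δ P ε₁ τ C sel u j).hPrev + C ∧
      (j : ℝ) ≤ (run n X f δ P ε₁ τ C sel u j).hCur + G * (2 + C * (G + 1)) := by
  induction j with
  | zero => exact ⟨0, by simp [run, initState]; linarith⟩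
  | succ j ih =>
    have hj' := (run_t_mono_succ (n := n) (X := X) (f := f) (δ := δ) (P := P) (ε₁ := ε₁) (τ := τ)
      (C := C) (sel := sel) u j).trans_lt hj
    obtain ⟨G, h1, h2, h3, h4⟩ := ih hj'
    simp only [run]
    set s := run n X f δ P ε₁ τ C sel u j with hs
    have hG : (0 : ℝ) ≤ G := Nat.cast_nonneg G
    have hprev : (0 : ℝ) ≤ s.hPrev := Nat.cast_nonneg _
    have hCG : 0 ≤ C * G := by positivity
    have hpos : 0 < ε₁ * τ₀ ^ G := by positivity
    have hgrow : ε₁ * τ₀ ^ (G + 1) ≤ τ * s.ε := by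
      calc ε₁ * τ₀ ^ (G + 1) = τ₀ * (ε₁ * τ₀ ^ G) := by ring
        _ ≤ τ * s.ε := by gcongr; linarith
    -- When growth and acceptance occur in the same pass, `ε` is multiplied by `τ` twice; this
    -- counts as a single growth.
    have hgrow2 : τ * s.ε ≤ τ * (τ * s.ε) :=
      le_mul_of_one_le_left (hpos.le.trans ((by gcongr <;> linarith : _ ≤ ε₁ * τ₀ ^ (G+1)).trans hgrow))
        (by linarith)
    have hj1 : ((j + 1 : ℕ) : ℝ) ≤ ((G + 1 : ℕ) : ℝ) * (2 + C * (((G + 1 : ℕ) : ℝ) + 1)) := by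
      push_cast
      nlinarith
    obtain ⟨ε', h', hε', hst⟩ := step_eq (X := X) (f := f) (δ := δ) (P := P) (τ := τ)
      (C := C) (sel := sel) s (u (j + 1)) hj'
    rcases hε' with ⟨g, rfl, rfl⟩ | ⟨g, rfl, rfl⟩ <;> rcases hst with ⟨-, he⟩ | ⟨-, he⟩ <;>
      rw [he] <;> dsimp only
    · refine ⟨G + 1, (hgrow.trans hgrow2).trans (le_max_left _ _), ?_, ?_, ?_⟩
      · push_cast; nlinarith
      · push_cast; linarith
      · simpa using hj1
    · refine ⟨G + 1, hgrow, ?_, ?_, ?_⟩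
      · push_cast; nlinarith
      · push_cast; linarith
      · simpa using hj1
    · refine ⟨G + 1, hgrow.trans (le_max_left _ _), ?_, ?_, ?_⟩
      · push_cast at g ⊢; nlinarith
      · push_cast; linarith [(Nat.cast_nonneg s.hCur : (0 : ℝ) ≤ s.hCur)]
      · simpa using hj1
    · refine ⟨G, h1, h2, ?_, ?_⟩
      · push_cast at g ⊢; linarith
      · push_cast; linarith

end Run

/-- The parameter `ε` exceeds any given level after a number of candidates that does not depend
on the run. -/
lemma exists_eps_large {d : ℕ} {X : Set (E d)} {f : E d → ℝ} {δ : ℝ} {ε₁ C τ₀ : ℝ}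
    {sel : ℕ → (ℕ → E d) → Finset ℕ} (hτ₀ : 1 < τ₀) (hC : 1 < C) (hε₁ : 0 < ε₁) (K : ℝ) :
    ∃ N : ℕ, ∀ (n p : ℕ) (P : Matrix (Fin p) (Fin d) ℝ) (τ : ℝ) (u : ℕ → E d) (j : ℕ),
      τ₀ ≤ τ → N ≤ j → (run n X f δ P ε₁ τ C sel u j).t < n →
      K ≤ (run n X f δ P ε₁ τ C sel u j).ε ∧ 0 ≤ (run n X f δ P ε₁ τ C sel u j).ε := by
  obtain ⟨G₀, hG₀⟩ := pow_unbounded_of_one_lt (K / ε₁) hτ₀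
  -- This is the bound on `j` obtained by chaining the last three inequalities of `exists_growth` at
  -- `G = G₀`. It increases with `G`, so `j ≥ N` forces `G ≥ G₀`.
  obtain ⟨N, hN⟩ := exists_nat_gt (1 + C * G₀ + C + G₀ * (2 + C * (G₀ + 1)))
  refine ⟨N, fun n p P τ u j hτ hj ht => ?_⟩
  obtain ⟨G, h1, h2, h3, h4⟩ := exists_growth hτ₀ hτ hC hε₁ u j ht
  have hGG : G₀ ≤ G := by
    by_contra! hlt
    have hle : (G : ℝ) ≤ G₀ := by exact_mod_cast hlt.le
    have hjN : (N : ℝ) ≤ j := by exact_mod_cast hj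
    have : 1 + C * G + C + G * (2 + C * (G + 1)) ≤ 1 + C * G₀ + C + G₀ * (2 + C * (G₀ + 1)) := by
      gcongr
    linarith
  refine ⟨?_, le_trans (by positivity) h1⟩
  rw [div_lt_iff₀ hε₁] at hG₀
  have : τ₀ ^ G₀ ≤ τ₀ ^ G := pow_le_pow_right₀ hτ₀.le hGG
  nlinarith

/-- A run terminates if the candidates visit every open subset of `X` infinitely often and the
projection is not zero. -/
lemma terminates_of_recurrent {d p n : ℕ} {X : Set (E d)} (hXint : (interior X).Nonempty)
    {f : E d → ℝ} {δ : ℝ} (hδ : δ < 1) {P : Matrix (Fin p) (Fin d) ℝ} {ε₁ τ C : ℝ}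
    {sel : ℕ → (ℕ → E d) → Finset ℕ} (hsel : ∀ t x, sel t x ⊆ Finset.Icc 1 t)
    (hτ : 1 < τ) (hC : 1 < C) (hε₁ : 0 < ε₁) (hn : 1 ≤ n) (hP : (∃ v, proj P v ≠ 0) ∨ d = 0)
    {u : ℕ → E d}
    (hrec : ∀ W : Set (E d), IsOpen W → W.Nonempty → W ⊆ X → ∀ J, ∃ j ≥ J, u j ∈ W) :
    Terminates n X f δ P ε₁ τ C sel u := by
  by_contra hT
  have hlt : ∀ j, (run n X f δ P ε₁ τ C sel u j).t < n := fun j =>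
    lt_of_le_of_ne (run_t_le hn u j) fun h => hT ⟨j, h⟩
  obtain ⟨J, hJ⟩ : ∃ J, ∀ j ≥ J, (run n X f δ P ε₁ τ C sel u j).t =
      (run n X f δ P ε₁ τ C sel u J).t := by
    have hb : BddAbove (Set.range fun j => (run n X f δ P ε₁ τ C sel u j).t) :=
      ⟨n, by rintro _ ⟨j, rfl⟩; exact (hlt j).le⟩
    obtain ⟨J, hJ⟩ := Nat.sSup_mem (Set.range_nonempty _) hb
    refine ⟨J, fun j hj => le_antisymm ?_ (run_t_mono u hj)⟩
    exact (le_csSup hb ⟨j, rfl⟩).trans hJ.symm.le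
  have hx : ∀ j ≥ J, (run n X f δ P ε₁ τ C sel u j).x = (run n X f δ P ε₁ τ C sel u J).x := by
    intro j hj
    induction j, hj using Nat.le_induction with
    | base => rfl
    | succ j hj ih =>
      have h0 := hJ j hj
      have h1 := hJ (j + 1) (by omega)
      simp only [run] at h1 ⊢
      rcases step_archive (n := n) (X := X) (f := f) (δ := δ) (P := P) (τ := τ) (C := C)
        (sel := sel) (run n X f δ P ε₁ τ C sel u j) (u (j + 1)) with h | h
      · rw [h.2, ih]
      · omega
  set t := (run n X f δ P ε₁ τ C sel u J).t
  set x := (run n X f δ P ε₁ τ C sel u J).x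
  -- The archive is now frozen. Along a line directed by `v` with `P v ≠ 0`, only finitely many
  -- points share a projection with the archive; `W` is a neighbourhood of another point of this
  -- line, on which the projected distances to the archive exceed some `r > 0`.
  obtain ⟨W, hWo, hWn, hWX, K, hK⟩ : ∃ W : Set (E d), IsOpen W ∧ W.Nonempty ∧ W ⊆ X ∧ ∃ K : ℝ,
      ∀ y ∈ W, ∀ i ∈ Finset.Icc 1 t,
        fMax f x t ≤ f (x i) + K / √(1 - δ) * ‖proj P y - proj P (x i)‖ := by
    rcases hP with ⟨v, hv⟩ | hd
    · obtain ⟨a, ha⟩ := hXint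
      have hline : Tendsto (fun s : ℝ => a + s • v) (𝓝[≠] 0) (𝓝 a) := by
        have : Tendsto (fun s : ℝ => a + s • v) (𝓝 0) (𝓝 (a + (0 : ℝ) • v)) :=
          (by fun_prop : Continuous fun s : ℝ => a + s • v).tendsto 0
        rw [zero_smul, add_zero] at this
        exact this.mono_left nhdsWithin_le_nhds
      have hev : ∀ᶠ s : ℝ in 𝓝[≠] 0, a + s • v ∈ interior X :=
        hline.eventually (isOpen_interior.mem_nhds ha)
      have hinj : Function.Injective fun s : ℝ => proj P (a + s • v) := by
        intro s s' h
        simp only [proj_add, proj_smul, add_right_inj] at h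
        exact smul_left_injective ℝ hv h
      have hfin : {s : ℝ | ∃ i ∈ Finset.Icc 1 t, proj P (a + s • v) = proj P (x i)}.Finite := by
        refine (((Finset.Icc 1 t).finite_toSet.image fun i => proj P (x i)).preimage
          hinj.injOn).subset ?_
        rintro s ⟨i, hi, h⟩
        exact ⟨i, hi, h.symm⟩
      obtain ⟨s, hsX, hs⟩ : ∃ s : ℝ, a + s • v ∈ interior X ∧
          ∀ i ∈ Finset.Icc 1 t, proj P (a + s • v) ≠ proj P (x i) := by
        have h2 : ∀ᶠ s : ℝ in 𝓝[≠] 0,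
            s ∉ {s : ℝ | ∃ i ∈ Finset.Icc 1 t, proj P (a + s • v) = proj P (x i)} := by
          -- The value `0` may itself be bad; the other bad values form a closed set that avoids
          -- `0`.
          have h0 := (hfin.subset (Set.sdiff_subset (t := {0}))).isClosed.isOpen_compl.mem_nhds
            (fun h => h.2 rfl)
          filter_upwards [nhdsWithin_le_nhds h0, self_mem_nhdsWithin] with s h1 h2 h3
          exact h1 ⟨h3, h2⟩
        obtain ⟨s, h1, h2⟩ := (hev.and h2).exists
        exact ⟨s, h1, fun i hi h => h2 ⟨i, hi, h⟩⟩
      set y := a + s • v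
      obtain ⟨r, hr, hrs⟩ : ∃ r > 0, ∀ i ∈ Finset.Icc 1 t, r < ‖proj P y - proj P (x i)‖ := by
        have h : ∀ᶠ r : ℝ in 𝓝[>] 0, ∀ i ∈ Finset.Icc 1 t, r < ‖proj P y - proj P (x i)‖ := by
          rw [Finset.eventually_all]
          intro i hi
          exact nhdsWithin_le_nhds (gt_mem_nhds (norm_pos_iff.2 (sub_ne_zero.2 (hs i hi))))
        obtain ⟨r, h1, h2⟩ := (h.and self_mem_nhdsWithin).exists
        exact ⟨r, h2, h1⟩
      obtain ⟨B, hB⟩ : ∃ B : ℝ, ∀ i ∈ Finset.Icc 1 t, fMax f x t - f (x i) ≤ B :=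
        ((Finset.Icc 1 t).finite_toSet.image fun i => fMax f x t - f (x i)).bddAbove.imp
          fun B hB i hi => hB ⟨i, hi, rfl⟩
      have hc : 0 < √(1 - δ) := Real.sqrt_pos.2 (by linarith)
      refine ⟨interior X ∩ ⋂ i ∈ Finset.Icc 1 t, {z | r < ‖proj P z - proj P (x i)‖}, ?_,
        ⟨y, hsX, by simpa using hrs⟩, Set.inter_subset_left.trans interior_subset,
        max B 0 * √(1 - δ) / r, ?_⟩
      · refine isOpen_interior.inter (isOpen_biInter_finset fun i _ => ?_)
        exact isOpen_lt continuous_const ((continuous_proj P).sub continuous_const).norm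
      · rintro z ⟨-, hz⟩ i hi
        have hz' : r < ‖proj P z - proj P (x i)‖ := by
          simp only [Set.mem_iInter] at hz; exact hz i hi
        have h1 : max B 0 * √(1 - δ) / r / √(1 - δ) = max B 0 / r := by field_simp
        have h2 : max B 0 ≤ max B 0 / r * ‖proj P z - proj P (x i)‖ := by
          rw [div_mul_eq_mul_div, le_div_iff₀ hr]
          exact mul_le_mul_of_nonneg_left hz'.le (le_max_right _ _)
        rw [h1]
        linarith [hB i hi, le_max_left B 0]
    · subst hd
      refine ⟨interior X, isOpen_interior, hXint, interior_subset, 0, fun y _ i hi => ?_⟩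
      refine fMax_le _ _ (one_le_run_t u J) fun i' _ => ?_
      rw [Subsingleton.elim (x i') (x i)]
      simp
  obtain ⟨N, hN⟩ := exists_eps_large (X := X) (f := f) (δ := δ) (sel := sel) hτ hC hε₁ K
  -- The shift by one is there because the candidate `u (j + 1)` is tested in the state of index
  -- `j`.
  obtain ⟨j, hj, hjW⟩ := hrec W hWo hWn hWX (max J N + 1)
  obtain ⟨j, rfl⟩ : ∃ j', j = j' + 1 := ⟨j - 1, by omega⟩
  have hjJ : J ≤ j := by omega
  obtain ⟨hKε, h0⟩ := hN n p P τ u j le_rfl (by omega) (hlt j)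
  have hacc := step_accept (f := f) (δ := δ) (P := P) (C := C) (sel := sel)
    (run n X f δ P ε₁ τ C sel u j) (u (j + 1)) (hlt j) hτ.le h0 hKε (hWX hjW) (by
      rw [hJ j hjJ, hx j hjJ]
      exact fun i hi => hK _ hjW i (hsel _ _ hi))
  have h1 := hJ (j + 1) (by omega)
  have h2 := hJ j hjJ
  simp only [run] at h1
  omega

/-- Once `ε` is large compared with the Lipschitz constant, the best value found is at least the
value of every candidate. -/
lemma le_fMax_run {d p n : ℕ} {X : Set (E d)} {f : E d → ℝ} {k : NNReal}
    (hf : LipschitzOnWith k f X) {δ : ℝ} {P : Matrix (Fin p) (Fin d) ℝ}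
    {ε₁ τ C : ℝ} {sel : ℕ → (ℕ → E d) → Finset ℕ} (hτ : 1 < τ) {u : ℕ → E d}
    (hu : ∀ j, u j ∈ X) {K : ℝ} (hP : ∀ v, k * ‖v‖ ≤ K / √(1 - δ) * ‖proj P v‖) {j : ℕ}
    (ht : (run n X f δ P ε₁ τ C sel u j).t < n) (h0 : 0 ≤ (run n X f δ P ε₁ τ C sel u j).ε)
    (hK : K ≤ (run n X f δ P ε₁ τ C sel u j).ε) :
    f (u (j + 1)) ≤ fMax f (run n X f δ P ε₁ τ C sel u (j + 1)).x
      (run n X f δ P ε₁ τ C sel u (j + 1)).t := by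
  by_contra! hlt
  have hlt' := ((fMax_run_mono (n := n) (X := X) (f := f) (δ := δ) (P := P) (ε₁ := ε₁) (τ := τ)
    (C := C) (sel := sel) u) (Nat.le_succ j)).trans_lt hlt
  -- A candidate better than the archive satisfies `fMax < f u ≤ f (x i) + k * ‖u - x i‖` for every
  -- `i`, hence is accepted; it then enters the archive and bounds the new maximum from below.
  have hacc := step_accept (f := f) (δ := δ) (P := P) (C := C) (sel := sel)
    (run n X f δ P ε₁ τ C sel u j) (u (j + 1)) ht hτ.le h0 hK (hu _) (by
      intro i _
      have h1 := hf.dist_le_mul _ (hu (j + 1)) _ (run_x_mem (n := n) (X := X) (f := f) (δ := δ)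
        (P := P) (ε₁ := ε₁) (τ := τ) (C := C) (sel := sel) u hu j i)
      rw [Real.dist_eq, dist_eq_norm] at h1
      have h2 := hP (u (j + 1) - (run n X f δ P ε₁ τ C sel u j).x i)
      rw [proj_sub] at h2
      have h3 := le_abs_self (f (u (j + 1)) - f ((run n X f δ P ε₁ τ C sel u j).x i))
      linarith)
  refine hlt.not_ge ?_
  simp only [run]
  rw [hacc.1, hacc.2]
  have := le_fMax f (Function.update (run n X f δ P ε₁ τ C sel u j).x
      ((run n X f δ P ε₁ τ C sel u j).t + 1) (u (j + 1)))
      (i := (run n X f δ P ε₁ τ C sel u j).t + 1) (t := (run n X f δ P ε₁ τ C sel u j).t + 1)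
      ⟨by omega, le_rfl⟩
  rwa [Function.update_self] at this


/-! ### The uniform candidates -/

section Uniform

variable {Ω : Type*} [MeasurableSpace Ω] {μ : Measure Ω} {d : ℕ} {X : Set (E d)}

lemma volume_ne_zero_of_interior (hXint : (interior X).Nonempty) : volume X ≠ 0 :=
  ((isOpen_interior.measure_pos volume hXint).trans_le (measure_mono interior_subset)).ne'

/-- The probability that finitely many candidates all miss an open subset of `X` decays
geometrically in the number of candidates. -/
lemma exists_measure_forall_notMem_eq (hXc : IsCompact X) {W : Set (E d)} (hWo : IsOpen W)
    (hWn : W.Nonempty) (hWX : W ⊆ X) :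
    ∃ q : ENNReal, q < 1 ∧ ∀ {p : ℕ} {R : Ω → Matrix (Fin d) (Fin p) ℝ} {U : ℕ → Ω → E d},
      IsInput μ X R U → ∀ F : Finset ℕ, μ {ω | ∀ j ∈ F, U j ω ∉ W} = q ^ F.card := by
  have hint : (interior X).Nonempty := hWn.mono (interior_maximal hWX hWo)
  have h0 := volume_ne_zero_of_interior hint
  have htop : volume X ≠ ⊤ := hXc.measure_ne_top
  -- The ratio depends only on `X` and `W`, so one `q` serves all budgets.
  refine ⟨volume (X ∩ Wᶜ) / volume X, ?_, fun {p R U} h F => ?_⟩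
  · rw [ENNReal.div_lt_iff (Or.inl h0) (Or.inl htop), one_mul, ← Set.sdiff_eq,
      measure_sdiff hWX hWo.measurableSet.nullMeasurableSet
        (measure_ne_top_of_subset hWX htop)]
    exact ENNReal.sub_lt_self htop h0 (hWo.measure_pos volume hWn).ne'
  · have hset : {ω | ∀ j ∈ F, U j ω ∉ W} = ⋂ j ∈ F, U j ⁻¹' Wᶜ := by ext; simp
    rw [hset, h.iIndep_U.measure_inter_preimage_eq_mul F
      (sets := fun _ => Wᶜ) (fun _ _ => hWo.measurableSet.compl)]
    rw [Finset.prod_congr rfl fun j _ =>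
      (h.law_U j).measure_preimage h0 htop hWo.measurableSet.compl]
    simp

lemma ae_mem_of_isInput (hXc : IsCompact X) (hXint : (interior X).Nonempty) {p : ℕ}
    {R : Ω → Matrix (Fin d) (Fin p) ℝ} {U : ℕ → Ω → E d} (h : IsInput μ X R U) :
    ∀ᵐ ω ∂μ, ∀ j, U j ω ∈ X := by
  rw [ae_all_iff]
  intro j
  have := (h.law_U j).measure_preimage (volume_ne_zero_of_interior hXint) hXc.measure_ne_top
    hXc.measurableSet.compl
  rw [Set.inter_compl_self, measure_empty, ENNReal.zero_div] at this
  exact this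

/-- A countable basis reduces the statement to countably many pairs `(b, J)`. For each pair, the
event that `b` is never visited from `J` on has probability at most `q ^ L` for every `L`, hence
zero. -/
lemma ae_recurrent_of_isInput (hXc : IsCompact X) {p : ℕ}
    {R : Ω → Matrix (Fin d) (Fin p) ℝ} {U : ℕ → Ω → E d} (h : IsInput μ X R U) :
    ∀ᵐ ω ∂μ, ∀ W : Set (E d), IsOpen W → W.Nonempty → W ⊆ X → ∀ J, ∃ j ≥ J, U j ω ∈ W := by
  have hb := TopologicalSpace.isBasis_countableBasis (E d)
  have key : ∀ᵐ ω ∂μ, ∀ b ∈ TopologicalSpace.countableBasis (E d), b ⊆ X →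
      ∀ J, ∃ j ≥ J, U j ω ∈ b := by
    rw [ae_ball_iff (TopologicalSpace.countable_countableBasis (E d))]
    intro b hbm
    by_cases hbX : b ⊆ X
    · simp only [hbX, forall_const]
      rw [ae_all_iff]
      intro J
      obtain ⟨q, hq, hqF⟩ := exists_measure_forall_notMem_eq (μ := μ) hXc (hb.isOpen hbm)
        (TopologicalSpace.nonempty_of_mem_countableBasis hbm) hbX
      refine le_antisymm (ge_of_tendsto' (ENNReal.tendsto_pow_atTop_nhds_zero_of_lt_one hq)
        fun L => ?_) bot_le
      refine (measure_mono ?_).trans_eq ((hqF h (Finset.Ico J (J + L))).trans (by simp))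
      intro ω hω j hj hjb
      exact hω ⟨j, (Finset.mem_Ico.1 hj).1, hjb⟩
    · exact ae_of_all _ fun ω hX => absurd hX hbX
  filter_upwards [key] with ω hω W hWo ⟨y, hy⟩ hWX J
  obtain ⟨b, hbm, -, hbW⟩ := hb.exists_subset_of_mem_open hy hWo
  obtain ⟨j, hj, hjb⟩ := hω b hbm (hbW.trans hWX) J
  exact ⟨j, hj, hbW hjb⟩

end Uniform

/-! ### The Gaussian projection -/

section Gaussian

variable {Ω : Type*} [MeasurableSpace Ω] {μ : Measure Ω}

lemma ae_ne_zero_of_gaussian {Y : Ω → ℝ} (hY : Measurable Y)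
    (hlaw : μ.map Y = gaussianReal 0 1) : ∀ᵐ ω ∂μ, Y ω ≠ 0 := by
  have : NullSingletonClass (gaussianReal 0 1) := nullSingletonClass_gaussianReal one_ne_zero
  have h : μ.map Y {0} = 0 := by rw [hlaw]; exact measure_singleton 0
  rw [Measure.map_apply hY (measurableSet_singleton 0)] at h
  exact measure_eq_zero_iff_ae_notMem.1 h

lemma memLp_of_gaussian {Y : Ω → ℝ} (hY : Measurable Y)
    (hlaw : μ.map Y = gaussianReal 0 1) (q : NNReal) : MemLp Y q μ := by
  have h : MemLp id q (μ.map Y) := by rw [hlaw]; exact memLp_id_gaussianReal q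
  exact (memLp_map_measure_iff aestronglyMeasurable_id hY.aemeasurable).1 h

lemma integral_pow_of_gaussian {Y : Ω → ℝ} (hY : Measurable Y)
    (hlaw : μ.map Y = gaussianReal 0 1) (q : ℕ) :
    ∫ ω, Y ω ^ q ∂μ = ∫ x, x ^ q ∂(gaussianReal 0 1) := by
  rw [← hlaw, integral_map hY.aemeasurable (by fun_prop)]

lemma integral_sq_gaussianReal : ∫ x, x ^ 2 ∂(gaussianReal 0 1) = 1 := by
  have h := variance_id_gaussianReal (μ := 0) (v := 1)
  rw [variance_eq_integral aemeasurable_id] at h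
  simpa [integral_id_gaussianReal] using h

/-- The entries of the Gram matrix of a Gaussian matrix concentrate around their means. -/
lemma measure_gram_deviation_le [IsProbabilityMeasure μ] {d p : ℕ} (hp : 1 ≤ p) {R : Ω → Matrix (Fin d) (Fin p) ℝ}
    (hm : ∀ i j, Measurable fun ω => R ω i j)
    (hlaw : ∀ i j, μ.map (fun ω => R ω i j) = gaussianReal 0 1)
    (hind : iIndepFun (fun (q : Fin d × Fin p) ω => R ω q.1 q.2) μ) (i k : Fin d)
    {c : ℝ} (hc : 0 < c) :
    μ {ω | c ≤ |(∑ r, R ω i r * R ω k r) / p - if i = k then 1 else 0|} ≤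
      ENNReal.ofReal ((∫ x, x ^ 4 ∂(gaussianReal 0 1)) / c ^ 2) / p := by
  set K := ∫ x, x ^ 4 ∂(gaussianReal 0 1) with hK
  have hp0 : (0 : ℝ) < p := by exact_mod_cast hp
  set Y : Fin p → Ω → ℝ := fun r ω => R ω i r * R ω k r with hY
  have h4 : ∀ i r, MemLp (fun ω => R ω i r) 4 μ := fun i r =>
    memLp_of_gaussian (hm i r) (hlaw i r) 4
  have h2 : ∀ i r, MemLp (fun ω => R ω i r) 2 μ := fun i r =>
    memLp_of_gaussian (hm i r) (hlaw i r) 2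
  have hYL : ∀ r, MemLp (Y r) 2 μ := fun r => by
    have : ENNReal.HolderTriple 4 4 2 := ⟨by
      rw [← two_mul, show (4 : ENNReal) = 2 * 2 by norm_num,
        ENNReal.mul_inv (by simp) (by simp), ← mul_assoc,
        ENNReal.mul_inv_cancel (by simp) (by simp), one_mul]⟩
    exact (h4 k r).mul (h4 i r)
  have hI4 : ∀ i r, Integrable (fun ω => R ω i r ^ 4) μ := fun i r => by
    have := (h4 i r).integrable_norm_pow (p := 4) (by norm_num)
    refine this.congr (ae_of_all _ fun ω => ?_)
    simp only [Real.norm_eq_abs]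
    exact Even.pow_abs (by decide) _
  have hmean : ∀ r, ∫ ω, Y r ω ∂μ = if i = k then 1 else 0 := fun r => by
    split_ifs with h
    · subst h
      rw [← integral_sq_gaussianReal, ← integral_pow_of_gaussian (hm i r) (hlaw i r)]
      simp [hY, sq]
    · have hi : IndepFun (fun ω => R ω i r) (fun ω => R ω k r) μ :=
        hind.indepFun (i := (i, r)) (j := (k, r)) (by simp [h])
      rw [hY, hi.integral_fun_mul_eq_mul_integral (hm i r).aestronglyMeasurable
        (hm k r).aestronglyMeasurable]
      have := integral_pow_of_gaussian (hm i r) (hlaw i r) 1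
      simp only [pow_one, integral_id_gaussianReal] at this
      rw [this, zero_mul]
  have hvar : ∀ r, Var[Y r; μ] ≤ K := fun r => by
    refine (variance_le_expectation_sq (hYL r).aestronglyMeasurable).trans ?_
    -- The inequality `a² b² ≤ (a⁴ + b⁴) / 2` treats `i = k` and `i ≠ k` at once.
    have hle : ∫ ω, Y r ω ^ 2 ∂μ ≤ ∫ ω, (R ω i r ^ 4 + R ω k r ^ 4) / 2 ∂μ := by
      refine integral_mono (hYL r).integrable_sq (((hI4 i r).add (hI4 k r)).div_const 2) fun ω => ?_
      simp only [hY]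
      nlinarith [sq_nonneg (R ω i r ^ 2 - R ω k r ^ 2)]
    refine hle.trans_eq ?_
    rw [integral_div, integral_add (hI4 i r) (hI4 k r),
      integral_pow_of_gaussian (hm i r) (hlaw i r), integral_pow_of_gaussian (hm k r) (hlaw k r)]
    ring
  -- `Y r` and `Y s` are built from entries in distinct columns of `R`.
  have hindY : Set.Pairwise (↑(Finset.univ : Finset (Fin p))) fun r s => Y r ⟂ᵢ[μ] Y s := by
    intro r _ s _ hrs
    have := hind.indepFun_prodMk_prodMk (fun q => hm q.1 q.2) (i, r) (k, r) (i, s) (k, s)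
      (by simp [hrs]) (by simp [hrs]) (by simp [hrs]) (by simp [hrs])
    exact this.comp (measurable_fst.mul measurable_snd) (measurable_fst.mul measurable_snd)
  have hS : MemLp (∑ r, Y r) 2 μ := memLp_finsetSum' _ fun r _ => hYL r
  have hSvar : Var[∑ r, Y r; μ] ≤ p * K := by
    rw [IndepFun.variance_sum (fun r _ => hYL r) hindY]
    refine (Finset.sum_le_sum fun r _ => hvar r).trans_eq ?_
    simp
  have hSmean : ∫ ω, (∑ r, Y r) ω ∂μ = p * if i = k then 1 else 0 := by
    simp only [Finset.sum_apply]
    rw [integral_finsetSum _ fun r _ => (hYL r).integrable (by norm_num)]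
    simp only [hmean]
    simp
  have hcheb := meas_ge_le_variance_div_sq hS (mul_pos hp0 hc)
  calc μ {ω | c ≤ |(∑ r, R ω i r * R ω k r) / p - if i = k then 1 else 0|}
      ≤ μ {ω | p * c ≤ |(∑ r, Y r) ω - ∫ ω, (∑ r, Y r) ω ∂μ|} := by
        refine measure_mono fun ω hω => ?_
        simp only [Set.mem_ofPred_eq] at hω ⊢
        rw [hSmean, Finset.sum_apply]
        calc (p : ℝ) * c ≤ p * |(∑ r, R ω i r * R ω k r) / p - if i = k then 1 else 0| := by gcongr
          _ = |p * ((∑ r, R ω i r * R ω k r) / p - if i = k then 1 else 0)| := by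
            rw [abs_mul, abs_of_pos hp0]
          _ = _ := by rw [mul_sub, mul_div_cancel₀ _ hp0.ne']
    _ ≤ ENNReal.ofReal (Var[∑ r, Y r; μ] / (p * c) ^ 2) := hcheb
    _ ≤ ENNReal.ofReal (K / c ^ 2 / p) := by
        refine ENNReal.ofReal_le_ofReal ?_
        calc Var[∑ r, Y r; μ] / (p * c) ^ 2 ≤ (p * K) / (p * c) ^ 2 := by gcongr
          _ = K / c ^ 2 / p := by field_simp
    _ = ENNReal.ofReal (K / c ^ 2) / p := by
        rw [ENNReal.ofReal_div_of_pos hp0, ENNReal.ofReal_natCast]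

/-- A matrix with almost orthonormal columns does not contract by more than a factor `2`. -/
lemma norm_le_two_mul_norm_proj {d p : ℕ} (A : Matrix (Fin d) (Fin p) ℝ)
    (h : ∀ i k, |(∑ r, A i r * A k r) / p - if i = k then 1 else 0| < 1 / (2 * (d + 1)))
    (v : E d) : ‖v‖ ≤ 2 * ‖proj (fun i j => (1 / √(p : ℝ)) * A j i) v‖ := by
  -- With `c * d ≤ 1 / 2` and Cauchy–Schwarz, `‖P v‖² ≥ ‖v‖² - c (∑ |v i|)² ≥ ‖v‖² / 2`, which is
  -- stronger than needed.
  set c : ℝ := 1 / (2 * (d + 1)) with hc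
  have hc0 : 0 < c := by positivity
  have hcd : c * d ≤ 1 / 2 := by
    rw [hc, div_mul_eq_mul_div, div_le_iff₀ (by positivity)]; linarith
  have hsq : (1 / √(p : ℝ)) ^ 2 = 1 / p := by rw [div_pow, Real.sq_sqrt (by positivity), one_pow]
  have hexp : ‖proj (fun i j => (1 / √(p : ℝ)) * A j i) v‖ ^ 2 =
      ∑ i, ∑ k, v i * v k * ((∑ r, A i r * A k r) / p) := by
    rw [EuclideanSpace.norm_sq_eq]
    have : ∀ r, ‖(proj (fun i j => (1 / √(p : ℝ)) * A j i) v) r‖ ^ 2 =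
        ∑ i, ∑ k, v i * v k * (A i r * A k r / p) := fun r => by
      rw [Real.norm_eq_abs, sq_abs]
      simp only [proj, Matrix.mulVec, dotProduct]
      rw [sq, Finset.sum_mul_sum]
      refine Finset.sum_congr rfl fun i _ => Finset.sum_congr rfl fun k _ => ?_
      rw [div_eq_mul_one_div (A i r * A k r), ← hsq]; ring
    rw [Finset.sum_congr rfl fun r _ => this r, Finset.sum_comm]
    refine Finset.sum_congr rfl fun i _ => ?_
    rw [Finset.sum_comm]
    refine Finset.sum_congr rfl fun k _ => ?_
    rw [← Finset.mul_sum, Finset.sum_div]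
  have hv : ‖v‖ ^ 2 = ∑ i, ∑ k, v i * v k * (if i = k then 1 else 0) := by
    rw [EuclideanSpace.norm_sq_eq]
    refine Finset.sum_congr rfl fun i _ => ?_
    simp [sq]
  have hlow : ‖v‖ ^ 2 - c * (∑ i, |v i|) ^ 2 ≤
      ‖proj (fun i j => (1 / √(p : ℝ)) * A j i) v‖ ^ 2 := by
    rw [hexp, hv, sq (∑ i, |v i|), Finset.sum_mul_sum, Finset.mul_sum, ← Finset.sum_sub_distrib]
    refine Finset.sum_le_sum fun i _ => ?_
    rw [Finset.mul_sum, ← Finset.sum_sub_distrib]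
    refine Finset.sum_le_sum fun k _ => ?_
    have h1 : |v i * v k * ((∑ r, A i r * A k r) / p - if i = k then 1 else 0)| ≤
        c * (|v i| * |v k|) := by
      rw [abs_mul, abs_mul, mul_comm c]
      gcongr
      exact (h i k).le
    have h2 := neg_abs_le (v i * v k * ((∑ r, A i r * A k r) / p - if i = k then 1 else 0))
    rw [mul_sub] at h1 h2
    linarith
  have hcs : (∑ i, |v i|) ^ 2 ≤ d * ‖v‖ ^ 2 := by
    have := sq_sum_le_card_mul_sum_sq (s := Finset.univ) (f := fun i => |v i|)
    rw [EuclideanSpace.norm_sq_eq]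
    simpa using this
  have hfin : (‖v‖) ^ 2 ≤ (2 * ‖proj (fun i j => (1 / √(p : ℝ)) * A j i) v‖) ^ 2 := by
    nlinarith [mul_le_mul_of_nonneg_left hcs hc0.le, sq_nonneg ‖v‖]
  exact (sq_le_sq₀ (norm_nonneg _) (by positivity)).1 hfin

/-- A Gaussian projection onto a space of large dimension is bounded below with high
probability. -/
lemma exists_measure_contraction_le [IsProbabilityMeasure μ] (d : ℕ) :
    ∃ K : ENNReal, K ≠ ⊤ ∧ ∀ {p : ℕ}, 1 ≤ p → ∀ {R : Ω → Matrix (Fin d) (Fin p) ℝ},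
      (∀ i j, Measurable fun ω => R ω i j) →
      (∀ i j, μ.map (fun ω => R ω i j) = gaussianReal 0 1) →
      iIndepFun (fun (q : Fin d × Fin p) ω => R ω q.1 q.2) μ →
      μ {ω | ¬ ∀ v, ‖v‖ ≤ 2 * ‖proj (fun i j => (1 / √(p : ℝ)) * R ω j i) v‖} ≤ K / p := by
  set c : ℝ := 1 / (2 * (d + 1)) with hc
  set K := ENNReal.ofReal ((∫ x, x ^ 4 ∂(gaussianReal 0 1)) / c ^ 2)
  -- Union bound over the `d²` Gram entries.
  refine ⟨∑ _i : Fin d, ∑ _k : Fin d, K, by simp [K, ENNReal.mul_eq_top], ?_⟩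
  intro p hp R hm hlaw hind
  calc μ {ω | ¬ ∀ v, ‖v‖ ≤ 2 * ‖proj (fun i j => (1 / √(p : ℝ)) * R ω j i) v‖}
      ≤ μ (⋃ i, ⋃ k, {ω | c ≤ |(∑ r, R ω i r * R ω k r) / p - if i = k then 1 else 0|}) := by
        refine measure_mono fun ω hω => ?_
        by_contra hcon
        simp only [Set.mem_iUnion, Set.mem_ofPred_eq, not_exists, not_le] at hcon
        exact hω (norm_le_two_mul_norm_proj _ hcon)
    _ ≤ ∑ i, ∑ k, μ {ω | c ≤ |(∑ r, R ω i r * R ω k r) / p - if i = k then 1 else 0|} :=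
        (measure_iUnion_fintype_le _ _).trans
          (Finset.sum_le_sum fun i _ => measure_iUnion_fintype_le _ _)
    _ ≤ ∑ _i : Fin d, ∑ _k : Fin d, K / p := by
        gcongr with i _ k _
        exact measure_gram_deviation_le hp hm hlaw hind i k (by positivity)
    _ = _ := by simp only [Finset.sum_const, nsmul_eq_mul, mul_div_assoc]

end Gaussian


/-! ### The projection of the algorithm -/

section Projection

variable {d : ℕ} {δ β : ℝ}

lemma norm_proj_one {d p : ℕ} (h : p = d) (v : E d) :
    ‖proj (fun (i : Fin p) (j : Fin d) => if (i : ℕ) = (j : ℕ) then (1 : ℝ) else 0) v‖ = ‖v‖ := by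
  subst h
  congr 1
  ext i
  simp [proj, Matrix.mulVec, dotProduct, Fin.val_inj]

lemma norm_proj_projMatrix_of_not_pos (hδ : ¬ 0 < δ) (n : ℕ)
    (R : Matrix (Fin d) (Fin (projDim d δ β n)) ℝ) (v : E d) :
    ‖proj (projMatrix d δ β n R) v‖ = ‖v‖ := by
  have h : projMatrix d δ β n R =
      fun (i : Fin _) (j : Fin d) => if (i : ℕ) = (j : ℕ) then (1 : ℝ) else 0 := by
    ext i j; simp [projMatrix, hδ]
  rw [h]
  exact norm_proj_one (by simp [projDim, hδ]) v

lemma projMatrix_of_pos (hδ : 0 < δ) (n : ℕ) (R : Matrix (Fin d) (Fin (projDim d δ β n)) ℝ) :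
    projMatrix d δ β n R = fun i j => (1 / √(projDim d δ β n : ℝ)) * R j i := by
  ext i j; simp [projMatrix, hδ]

lemma sq_sub_cube_pos (hδ : 0 < δ) (hδ1 : δ < 1) : 0 < δ ^ 2 - δ ^ 3 := by
  have : δ ^ 2 - δ ^ 3 = δ ^ 2 * (1 - δ) := by ring
  rw [this]
  exact mul_pos (by positivity) (by linarith)

lemma one_le_projDim (hδ : 0 < δ) (hδ1 : δ < 1) (hβ : 1 < β) {n : ℕ} (hn : 1 ≤ n) :
    1 ≤ projDim d δ β n := by
  rw [projDim, if_pos hδ, Nat.one_le_ceil_iff]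
  have h1 : (1 : ℝ) ≤ n := by exact_mod_cast hn
  have := Real.log_pos (show 1 < β * n by nlinarith)
  exact div_pos (by linarith) (sq_sub_cube_pos hδ hδ1)

lemma tendsto_projDim (hδ : 0 < δ) (hδ1 : δ < 1) (hβ : 1 < β) :
    Tendsto (projDim d δ β) atTop atTop := by
  have h : projDim d δ β = fun n : ℕ => ⌈8 * Real.log (β * n) / (δ ^ 2 - δ ^ 3)⌉₊ := by
    ext n; simp [projDim, hδ]
  rw [h]
  refine tendsto_nat_ceil_atTop.comp (Tendsto.atTop_div_const (sq_sub_cube_pos hδ hδ1) ?_)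
  refine Tendsto.const_mul_atTop (by norm_num) (Real.tendsto_log_atTop.comp ?_)
  exact tendsto_natCast_atTop_atTop.const_mul_atTop (by linarith)

variable {X : Set (E d)} {Ω : Type*} [MeasurableSpace Ω] {μ : Measure Ω}

/-- A single Gaussian entry is almost surely nonzero, whatever the size of `d'`. In dimension `d =
0` there is no nonzero vector, hence the alternative. -/
lemma ae_exists_proj_ne_zero (hδ1 : δ < 1) (hβ : 1 < β) {n : ℕ} (hn : 1 ≤ n)
    {R : Ω → Matrix (Fin d) (Fin (projDim d δ β n)) ℝ} {U : ℕ → Ω → E d}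
    (h : IsInput μ X R U) :
    ∀ᵐ ω ∂μ, (∃ v, proj (projMatrix d δ β n (R ω)) v ≠ 0) ∨ d = 0 := by
  rcases Nat.eq_zero_or_pos d with hd | hd
  · exact ae_of_all _ fun _ => Or.inr hd
  let i : Fin d := ⟨0, hd⟩
  by_cases hδ : 0 < δ
  · have hp := one_le_projDim (d := d) hδ hδ1 hβ hn
    let r : Fin (projDim d δ β n) := ⟨0, hp⟩
    filter_upwards [ae_ne_zero_of_gaussian (h.measurable_R i r) (h.law_R i r)] with ω hω
    refine Or.inl ⟨EuclideanSpace.single i 1, fun h0 => ?_⟩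
    have h1 := congrArg (fun w => w r) h0
    rw [projMatrix_of_pos hδ] at h1
    have hs : √(projDim d δ β n : ℝ) ≠ 0 :=
      (Real.sqrt_pos.2 (by exact_mod_cast hp)).ne'
    have h2 : (1 / √(projDim d δ β n : ℝ)) * R ω i r = 0 := by
      have h3 := congrFun (Matrix.mulVec_single_one
        (fun (r : Fin (projDim d δ β n)) (j : Fin d) => (1 / √(projDim d δ β n : ℝ)) * R ω j r) i) r
      exact h3.symm.trans h1
    exact mul_ne_zero (one_div_ne_zero hs) hω h2
  · refine ae_of_all _ fun ω => Or.inl ⟨EuclideanSpace.single i 1, fun h0 => ?_⟩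
    have := norm_proj_projMatrix_of_not_pos hδ n (R ω) (EuclideanSpace.single i 1)
    rw [h0] at this
    simp at this

lemma tendsto_measure_contraction [IsProbabilityMeasure μ] (hδ1 : δ < 1) (hβ : 1 < β)
    {R : (n : ℕ) → Ω → Matrix (Fin d) (Fin (projDim d δ β n)) ℝ} {U : ℕ → ℕ → Ω → E d}
    (h : ∀ n, IsInput μ X (R n) (U n)) :
    Tendsto (fun n => μ {ω | ¬ ∀ v, ‖v‖ ≤ 2 * ‖proj (projMatrix d δ β n (R n ω)) v‖})
      atTop (𝓝 0) := by
  by_cases hδ : 0 < δ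
  · obtain ⟨K, hK, hle⟩ := exists_measure_contraction_le (μ := μ) d
    have hlim : Tendsto (fun n => K / (projDim d δ β n : ENNReal)) atTop (𝓝 0) := by
      have h1 : Tendsto (fun n => (projDim d δ β n : ENNReal)) atTop (𝓝 ⊤) :=
        ENNReal.tendsto_nat_nhds_top.comp (tendsto_projDim hδ hδ1 hβ)
      simpa using ENNReal.Tendsto.const_div h1 (Or.inr hK)
    refine tendsto_of_tendsto_of_tendsto_of_le_of_le' tendsto_const_nhds hlim
      (Eventually.of_forall fun _ => bot_le) ?_
    filter_upwards [eventually_ge_atTop 1] with n hn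
    simp only [projMatrix_of_pos hδ]
    exact hle (one_le_projDim hδ hδ1 hβ hn) (h n).measurable_R (h n).law_R (h n).iIndep_R
  · have : ∀ n, {ω | ¬ ∀ v, ‖v‖ ≤ 2 * ‖proj (projMatrix d δ β n (R n ω)) v‖} = ∅ := fun n => by
      ext ω
      simp only [Set.mem_ofPred_eq, Set.mem_empty_iff_false, iff_false, not_not]
      intro v
      rw [norm_proj_projMatrix_of_not_pos hδ]
      linarith [norm_nonneg v]
    simp only [this, measure_empty]
    exact tendsto_const_nhds

end Projection

/-! ### The regret -/

/-- A continuous function on a convex body is close to its supremum on some open set. -/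
lemma exists_open_near_sup {d : ℕ} {X : Set (E d)} (hXc : IsCompact X) (hXconv : Convex ℝ X)
    (hXint : (interior X).Nonempty) {f : E d → ℝ} (hf : ContinuousOn f X) {η : ℝ} (hη : 0 < η) :
    ∃ W : Set (E d), IsOpen W ∧ W.Nonempty ∧ W ⊆ X ∧ ∀ y ∈ W, sSup (f '' X) - η < f y := by
  obtain ⟨z, hzX, hz⟩ := hXc.exists_sSup_image_eq (hXint.mono interior_subset) hf
  have hev : ∀ᶠ y in 𝓝[X] z, sSup (f '' X) - η < f y :=
    (hf z hzX).eventually (lt_mem_nhds (by linarith))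
  obtain ⟨O, hO, hzO, hOX⟩ := mem_nhdsWithin.1 hev
  -- The maximizer may lie on the boundary; convexity makes it a limit of interior points.
  have hcl : z ∈ closure (interior X) := by
    rw [hXconv.closure_interior_eq_closure_of_nonempty_interior hXint]
    exact subset_closure hzX
  exact ⟨O ∩ interior X, hO.inter isOpen_interior, mem_closure_iff.1 hcl O hO hzO,
    Set.inter_subset_right.trans interior_subset,
    fun y hy => hOX ⟨hy.1, interior_subset hy.2⟩⟩

section Regret

variable {d p n : ℕ} {X : Set (E d)} {f : E d → ℝ} {δ : ℝ} {P : Matrix (Fin p) (Fin d) ℝ}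
  {ε₁ τ C : ℝ} {sel : ℕ → (ℕ → E d) → Finset ℕ} {u : ℕ → E d}

lemma regret_nonneg (hn : 1 ≤ n) (hb : BddAbove (f '' X)) (hu : ∀ j, u j ∈ X) :
    0 ≤ regret n X f δ P ε₁ τ C sel u :=
  sub_nonneg.2 (fMax_le _ _ hn fun i _ => le_csSup hb ⟨_, run_x_mem u hu _ i, rfl⟩)

/-- The regret is at most that of any candidate that is processed when `ε` is large. -/
lemma regret_le {k : NNReal} (hf : LipschitzOnWith k f X) (hτ : 1 < τ) (hu : ∀ j, u j ∈ X)
    (hT : Terminates n X f δ P ε₁ τ C sel u) {K : ℝ}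
    (hP : ∀ v, k * ‖v‖ ≤ K / √(1 - δ) * ‖proj P v‖) {j : ℕ} (hj : j + 1 < n)
    (h0 : 0 ≤ (run n X f δ P ε₁ τ C sel u j).ε) (hK : K ≤ (run n X f δ P ε₁ τ C sel u j).ε) :
    regret n X f δ P ε₁ τ C sel u ≤ sSup (f '' X) - f (u (j + 1)) := by
  have ht : (run n X f δ P ε₁ τ C sel u j).t < n := (run_t_le_succ u j).trans_lt hj
  have hTn : (run n X f δ P ε₁ τ C sel u
      (sInf {j | (run n X f δ P ε₁ τ C sel u j).t = n})).t = n := Nat.sInf_mem hT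
  -- The loop is still running after `j` candidates, so the archive is read off at index `j + 1` or
  -- later, and the maximum only increases up to then.
  have hle : j + 1 ≤ sInf {j | (run n X f δ P ε₁ τ C sel u j).t = n} := by
    by_contra! hlt
    have := run_t_mono (n := n) (X := X) (f := f) (δ := δ) (P := P) (ε₁ := ε₁) (τ := τ)
      (C := C) (sel := sel) u (Nat.lt_succ_iff.1 hlt)
    simp only [hTn] at this
    omega
  have h1 := le_fMax_run hf hτ hu hP ht h0 hK
  have h2 := fMax_run_mono (n := n) (X := X) (f := f) (δ := δ) (P := P) (ε₁ := ε₁) (τ := τ)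
      (C := C) (sel := sel) u hle
  simp only [hTn] at h2
  exact sub_le_sub_left (h1.trans h2) _

end Regret

end ECPv2

theorem mainTheorem2
    {d : ℕ} (X : Set (ECPv2.E d)) (hXc : IsCompact X) (hXconv : Convex ℝ X)
    (hXint : (interior X).Nonempty)
    (f : ECPv2.E d → ℝ) (k : NNReal) (hk : 0 < k) (hf : LipschitzOnWith k f X)
    (δ : ℝ) (hδ0 : 0 ≤ δ) (hδ1 : δ < 1) (ε₁ : ℝ) (hε₁ : 0 < ε₁) (m : ℕ) (hm : 1 ≤ m)
    (β : ℝ) (hβ : 1 < β)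
    (τ : ℕ → ℝ) (hτ : ∃ τ₀ : ℝ, 1 < τ₀ ∧ ∀ n, τ₀ ≤ τ n)
    (C : ℝ) (hC : 1 < C)
    (sel : ℕ → (ℕ → ECPv2.E d) → Finset ℕ)
    (hsel : ∀ t x, ECPv2.IsWorstSet f m t x (sel t x))
    {Ω : Type*} [MeasurableSpace Ω] (μ : Measure Ω) [IsProbabilityMeasure μ]
    (R : (n : ℕ) → Ω → Matrix (Fin d) (Fin (ECPv2.projDim d δ β n)) ℝ)
    (U : ℕ → ℕ → Ω → ECPv2.E d)
    (hRU : ∀ n, ECPv2.IsInput μ X (R n) (U n)) :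
    (∀ n, 1 ≤ n → ∀ᵐ ω ∂μ,
      ECPv2.Terminates n X f δ (ECPv2.projMatrix d δ β n (R n ω)) ε₁ (τ n) C sel
        (fun j => U n j ω)) ∧
    TendstoInMeasure μ
      (fun n ω =>
        ECPv2.regret n X f δ (ECPv2.projMatrix d δ β n (R n ω)) ε₁ (τ n) C sel
          (fun j => U n j ω))
      atTop (fun _ => 0) := by
  obtain ⟨τ₀, hτ₀, hτ⟩ := hτ
  have hterm : ∀ n, 1 ≤ n → ∀ᵐ ω ∂μ,
      ECPv2.Terminates n X f δ (ECPv2.projMatrix d δ β n (R n ω)) ε₁ (τ n) C sel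
        (fun j => U n j ω) := by
    intro n hn
    filter_upwards [ECPv2.ae_recurrent_of_isInput hXc (hRU n),
      ECPv2.ae_exists_proj_ne_zero hδ1 hβ hn (hRU n)] with ω hrec hP
    exact ECPv2.terminates_of_recurrent hXint hδ1 (fun t x => (hsel t x).1)
      (hτ₀.trans_le (hτ n)) hC hε₁ hn hP hrec
  refine ⟨hterm, ?_⟩
  rw [tendstoInMeasure_iff_norm]
  intro η hη
  obtain ⟨W, hWo, hWn, hWX, hW⟩ :=
    ECPv2.exists_open_near_sup hXc hXconv hXint hf.continuousOn hη
  obtain ⟨q, hq, hqF⟩ := ECPv2.exists_measure_forall_notMem_eq (μ := μ) hXc hWo hWn hWX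
  -- At the level `2 * k * √(1 - δ)` the slope in the acceptance test is at least `2 * k`, which
  -- absorbs the factor `2` lost in the projection.
  obtain ⟨N, hN⟩ := ECPv2.exists_eps_large (X := X) (f := f) (δ := δ) (sel := sel) hτ₀ hC hε₁
    (2 * k * √(1 - δ))
  have hc : 0 < √(1 - δ) := Real.sqrt_pos.2 (by linarith)
  have hlim : Tendsto (fun n =>
      μ {ω | ¬ ∀ v, ‖v‖ ≤ 2 * ‖ECPv2.proj (ECPv2.projMatrix d δ β n (R n ω)) v‖} +
        q ^ (n - (N + 1))) atTop (𝓝 0) := by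
    have := (ECPv2.tendsto_measure_contraction hδ1 hβ hRU).add
      ((ENNReal.tendsto_pow_atTop_nhds_zero_of_lt_one hq).comp (tendsto_sub_atTop_nat (N + 1)))
    simpa using this
  refine tendsto_of_tendsto_of_tendsto_of_le_of_le' tendsto_const_nhds hlim
      (Eventually.of_forall fun _ => bot_le) ?_
  filter_upwards [eventually_ge_atTop 1] with n hn
  have hmiss : μ {ω | ∀ j ∈ Finset.Ico (N + 1) n, U n j ω ∉ W} = q ^ (n - (N + 1)) := by
    rw [hqF (hRU n), Nat.card_Ico]
  rw [← hmiss]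
  -- Almost surely, a regret of at least `η` requires that the projection contract too much or that
  -- all candidates `N + 1, …, n - 1` miss `W`.
  refine le_trans (measure_mono_ae ?_) (measure_union_le _ _)
  filter_upwards [hterm n hn, ECPv2.ae_mem_of_isInput hXc hXint (hRU n)] with ω hT hU hω
  by_contra hcon
  obtain ⟨hgood, hhit⟩ := not_or.1 hcon
  have hgood := not_not.1 hgood
  obtain ⟨j, hj, hjW⟩ : ∃ j ∈ Finset.Ico (N + 1) n, U n j ω ∈ W := by
    by_contra! h
    exact hhit h
  obtain ⟨hj1, hj2⟩ := Finset.mem_Ico.1 hj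
  obtain ⟨j, rfl⟩ : ∃ j', j = j' + 1 := ⟨j - 1, by omega⟩
  obtain ⟨hK, h0⟩ := hN n _ (ECPv2.projMatrix d δ β n (R n ω)) (τ n) (fun j => U n j ω) j (hτ n)
    (by omega) ((ECPv2.run_t_le_succ _ j).trans_lt hj2)
  have hreg := ECPv2.regret_le hf (hτ₀.trans_le (hτ n)) hU hT (fun v => by
    rw [mul_div_cancel_right₀ _ hc.ne', mul_comm 2, mul_assoc]
    exact mul_le_mul_of_nonneg_left (hgood v) k.2) hj2 h0 hK
  have hnn := ECPv2.regret_nonneg (δ := δ) (P := ECPv2.projMatrix d δ β n (R n ω)) (ε₁ := ε₁)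
    (τ := τ n) (C := C) (sel := sel) hn (hXc.bddAbove_image hf.continuousOn) hU
  have hω' : η ≤ ‖ECPv2.regret n X f δ (ECPv2.projMatrix d δ β n (R n ω)) ε₁ (τ n) C sel
      (fun j => U n j ω) - 0‖ := hω
  rw [sub_zero, Real.norm_of_nonneg hnn] at hω'
  linarith [hW _ hjW]
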